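/- For a bounded operator $T$ on a complex Hilbert space $H$, let $w(T)=\sup\{|\langle Th,h\rangle| : h\in H,\ \|h\|=1\}$ be its numerical radius. For bounded operators $a_1,\dots,a_n$ on $H$ and $k\in\mathbb N$ put $$w_k(a_1,\dots,a_n)=\sup\Big\{\,w\Big(\sum_{i=1}^n U_i\otimes a_i\Big) : U_i\in M_k(\mathbb C),\ \|U_i\|\le 1\Big\},$$ where $U_i\otimes a_i$ acts on the Hilbert space $\mathbb C^k\otimes H$ and $\|U_i\|$ is the operator norm of $U_i$ on $\mathbb C^k$ with the Euclidean norm, and let $w_{cb}(a_1,\dots,a_n)=\sup_{k} w_k(a_1,\dots,a_n)$ be the joint numerical radius. **Proposition.** Let $n\ge 1$, let $g_1,\dots,g_n$ be the standard generators of the free group $\mathbb F_n$, and let $\lambda$ be the left regular representation of $\mathbb F_n$ on $\ell^2(\mathbb F_n)$, given by $\lambda(g)\delta_h=\delta_{gh}$. Then $$w_{cb}(\lambda(g_1),\dots,\lambda(g_n)) = w\Big(\sum_{i=1}^n\lambda(g_i)\Big)=\sqrt{2n-1}.$$ -/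

import Mathlib

open scoped TensorProduct ENNReal

noncomputable section

namespace JointNumericalRadius

section NumericalRadius

variable {H : Type*} [NormedAddCommGroup H] [InnerProductSpace ℂ H]

/-- The numerical radius `w(T) = sup { |⟨T h, h⟩| : ‖h‖ = 1 }` of a bounded operator. -/
def numericalRadius (T : H →L[ℂ] H) : ℝ :=
  sSup {r : ℝ | ∃ h : H, ‖h‖ = 1 ∧ r = ‖inner ℂ (T h) h‖}

/-- The operator `U₁ ⊗ a₁ + ⋯ + Uₙ ⊗ aₙ` on the Hilbert space `ℂᵏ ⊗ H`, where the matrix `Uᵢ`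
acts on the Euclidean space `ℂᵏ`. -/
def tensorSum {n k : ℕ} (U : Fin n → Matrix (Fin k) (Fin k) ℂ) (a : Fin n → H →L[ℂ] H) :
    (EuclideanSpace ℂ (Fin k) ⊗[ℂ] H) →L[ℂ] (EuclideanSpace ℂ (Fin k) ⊗[ℂ] H) :=
  ∑ i, TensorProduct.mapL (Matrix.toEuclideanCLM (𝕜 := ℂ) (U i)) (a i)

/-- `w_k(a₁, …, aₙ)`, the supremum of `w(∑ Uᵢ ⊗ aᵢ)` over all `k × k` complex matrices `Uᵢ` of
operator norm at most one. -/
def jointNumericalRadiusAt (k : ℕ) {n : ℕ} (a : Fin n → H →L[ℂ] H) : ℝ :=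
  sSup {r : ℝ | ∃ U : Fin n → Matrix (Fin k) (Fin k) ℂ,
    (∀ i, ‖Matrix.toEuclideanCLM (𝕜 := ℂ) (U i)‖ ≤ 1) ∧ r = numericalRadius (tensorSum U a)}

/-- The joint numerical radius `w_cb(a₁, …, aₙ) = sup_k w_k(a₁, …, aₙ)`. (The index `k = 0`
contributes the value `0` and so does not affect the supremum.) -/
def jointNumericalRadius {n : ℕ} (a : Fin n → H →L[ℂ] H) : ℝ :=
  sSup {r : ℝ | ∃ k : ℕ, r = jointNumericalRadiusAt k a}

/-! The suprema above are suprema of bounded sets, for all arguments. -/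

theorem norm_inner_le_of_unit (T : H →L[ℂ] H) {h : H} (hh : ‖h‖ = 1) :
    ‖inner ℂ (T h) h‖ ≤ ‖T‖ := by
  calc ‖inner ℂ (T h) h‖ ≤ ‖T h‖ * ‖h‖ := norm_inner_le_norm _ _
    _ ≤ ‖T‖ := by simpa [hh] using T.le_opNorm h

theorem bddAbove_numericalRadius (T : H →L[ℂ] H) :
    BddAbove {r : ℝ | ∃ h : H, ‖h‖ = 1 ∧ r = ‖inner ℂ (T h) h‖} := by
  refine ⟨‖T‖, ?_⟩
  rintro _ ⟨h, hh, rfl⟩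
  exact norm_inner_le_of_unit T hh

theorem numericalRadius_le_norm (T : H →L[ℂ] H) : numericalRadius T ≤ ‖T‖ := by
  refine Real.sSup_le ?_ (norm_nonneg _)
  rintro _ ⟨h, hh, rfl⟩
  exact norm_inner_le_of_unit T hh

theorem norm_tensorSum_le {n k : ℕ} (U : Fin n → Matrix (Fin k) (Fin k) ℂ)
    (hU : ∀ i, ‖Matrix.toEuclideanCLM (𝕜 := ℂ) (U i)‖ ≤ 1) (a : Fin n → H →L[ℂ] H) :
    ‖tensorSum U a‖ ≤ ∑ i, ‖a i‖ := by
  unfold tensorSum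
  refine norm_sum_le_of_le (E := (EuclideanSpace ℂ (Fin k) ⊗[ℂ] H) →L[ℂ]
    (EuclideanSpace ℂ (Fin k) ⊗[ℂ] H)) Finset.univ fun i _ => ?_
  exact (TensorProduct.norm_mapL_le _ _).trans (mul_le_of_le_one_left (norm_nonneg _) (hU i))

theorem bddAbove_jointNumericalRadiusAt (k : ℕ) {n : ℕ} (a : Fin n → H →L[ℂ] H) :
    BddAbove {r : ℝ | ∃ U : Fin n → Matrix (Fin k) (Fin k) ℂ,
      (∀ i, ‖Matrix.toEuclideanCLM (𝕜 := ℂ) (U i)‖ ≤ 1) ∧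
        r = numericalRadius (tensorSum U a)} := by
  refine ⟨∑ i, ‖a i‖, ?_⟩
  rintro _ ⟨U, hU, rfl⟩
  exact (numericalRadius_le_norm _).trans (norm_tensorSum_le U hU a)

theorem bddAbove_jointNumericalRadius {n : ℕ} (a : Fin n → H →L[ℂ] H) :
    BddAbove {r : ℝ | ∃ k : ℕ, r = jointNumericalRadiusAt k a} := by
  refine ⟨∑ i, ‖a i‖, ?_⟩
  rintro _ ⟨k, rfl⟩
  refine Real.sSup_le ?_ (Finset.sum_nonneg fun i _ => norm_nonneg _)
  rintro _ ⟨U, hU, rfl⟩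
  exact (numericalRadius_le_norm _).trans (norm_tensorSum_le U hU a)

end NumericalRadius

section LeftRegular

variable {G : Type*} [Group G]

theorem memℓp_translate (g : G) (f : lp (fun _ : G => ℂ) 2) :
    Memℓp (fun h : G => (f : G → ℂ) (g⁻¹ * h)) 2 := by
  have hf := (memℓp_gen_iff (by norm_num : 0 < (2 : ℝ≥0∞).toReal)).1 (lp.memℓp f)
  exact memℓp_gen ((Equiv.mulLeft g⁻¹).summable_iff.2 hf)

/-- Left translation by `g` on `ℓ²(G)`, `(λ(g) f)(h) = f(g⁻¹ h)`, as a linear isometry. -/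
def leftRegularIsometry (g : G) : lp (fun _ : G => ℂ) 2 →ₗᵢ[ℂ] lp (fun _ : G => ℂ) 2 where
  toFun f := ⟨fun h => (f : G → ℂ) (g⁻¹ * h), memℓp_translate g f⟩
  map_add' _ _ := rfl
  map_smul' _ _ := rfl
  norm_map' f := by
    have h2 : 0 < (2 : ℝ≥0∞).toReal := by norm_num
    rw [lp.norm_eq_tsum_rpow h2, lp.norm_eq_tsum_rpow h2]
    congr 1
    exact (Equiv.mulLeft g⁻¹).tsum_eq fun h => ‖(f : G → ℂ) h‖ ^ (2 : ℝ≥0∞).toReal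

/-- The left regular representation `λ` of the discrete group `G` on `ℓ²(G)`. -/
def leftRegular (g : G) : lp (fun _ : G => ℂ) 2 →L[ℂ] lp (fun _ : G => ℂ) 2 :=
  (leftRegularIsometry g).toContinuousLinearMap

theorem leftRegular_apply (g : G) (f : lp (fun _ : G => ℂ) 2) (h : G) :
    (leftRegular g f : G → ℂ) h = (f : G → ℂ) (g⁻¹ * h) := rfl

/-- `λ(g) δ_h = δ_{gh}`. -/
theorem leftRegular_single [DecidableEq G] (g h : G) (c : ℂ) :
    leftRegular g (lp.single 2 h c) = lp.single 2 (g * h) c := by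
  ext x
  rw [leftRegular_apply]
  by_cases hx : x = g * h
  · subst hx; simp
  · have hx' : g⁻¹ * x ≠ h := fun hh => hx (by rw [← hh]; group)
    simp [lp.single_apply, hx, hx']

end LeftRegular

end JointNumericalRadius

end

open scoped TensorProduct ENNReal

/-! Multiplication by the generators and their inverses makes `FreeGroup (Fin n)` a 2n-regular tree.
Viewing a tensor as a vector-valued function x on it, fibrewise Cauchy–Schwarz removes the matrices
and leaves half the adjacency form of the tree at g ↦ ‖x(g)‖. With q = 2n - 1, a Schur test
weighting outward steps by q^(-1/2) and inward ones by q^(1/2) bounds that form by 2√q, whatever the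
matrix size (`sum_tsum_mul_translate_le`). Conversely, truncations of the radial function q^(-|g|/2)
have equal mass on all nontrivial spheres within the cutoff, so boundary losses become negligible
and √q is approached (`sqrt_mul_le_numericalRadius_mul`). The choice k = 1, U = 1 links the two
radii. -/

namespace JointNumericalRadius

open Finset

/-! ### Tensors as vector-valued functions on the group -/

section Fiber

variable {G : Type*} {E : Type*} [NormedAddCommGroup E] [InnerProductSpace ℂ E]

/-- The value at `g` of an element of `E ⊗ ℓ²(G)`, seen as an `E`-valued function on `G`. -/
noncomputable def fiber (g : G) : (E ⊗[ℂ] lp (fun _ : G => ℂ) 2) →ₗ[ℂ] E :=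
  TensorProduct.lift
    { toFun := fun v =>
        { toFun := fun h => (h : G → ℂ) g • v
          map_add' := fun h h' => by simp [add_smul]
          map_smul' := fun c h => by simp [mul_smul] }
      map_add' := fun v v' => by ext h; simp
      map_smul' := fun c v => by ext h; exact smul_comm _ _ _ }

theorem fiber_tmul (g : G) (v : E) (h : lp (fun _ : G => ℂ) 2) :
    fiber g (v ⊗ₜ h) = (h : G → ℂ) g • v := rfl

/-- The tensor product is not completed, so induction reduces this to pure tensors. -/
theorem hasSum_inner_fiber (x y : E ⊗[ℂ] lp (fun _ : G => ℂ) 2) :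
    HasSum (fun g => inner ℂ (fiber g x) (fiber g y)) (inner ℂ x y) := by
  induction x using TensorProduct.induction_on with
  | zero => simp
  | add x x' hx hx' => simpa [inner_add_left] using hx.add hx'
  | tmul v h =>
    induction y using TensorProduct.induction_on with
    | zero => simp
    | add y y' hy hy' => simpa [inner_add_right] using hy.add hy'
    | tmul w k =>
      have := (lp.hasSum_inner (𝕜 := ℂ) h k).mul_left (inner ℂ v w)
      rw [TensorProduct.inner_tmul]
      refine this.congr_fun fun g => ?_
      simp [fiber_tmul]
      ring

theorem hasSum_norm_fiber_sq (x : E ⊗[ℂ] lp (fun _ : G => ℂ) 2) :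
    HasSum (fun g => ‖fiber g x‖ ^ 2) (‖x‖ ^ 2) := by
  rw [← inner_self_eq_norm_sq (𝕜 := ℂ)]
  refine (Complex.hasSum_re (hasSum_inner_fiber x x)).congr_fun fun g => ?_
  exact (inner_self_eq_norm_sq (𝕜 := ℂ) _).symm

theorem fiber_mapL_leftRegular [Group G] (A : E →L[ℂ] E) (s g : G) (x : E ⊗[ℂ] lp (fun _ : G => ℂ) 2) :
    fiber g (TensorProduct.mapL A (leftRegular s) x) = A (fiber (s⁻¹ * g) x) := by
  induction x using TensorProduct.induction_on with
  | zero => simp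
  | add x y hx hy => simp only [map_add, hx, hy]
  | tmul v h => simp [fiber_tmul, leftRegular_apply]

end Fiber

/-! ### Word length and sphere sizes in the free group -/

section WordLength

variable {α : Type*}

theorem mk_singleton_not (i : α) (b : Bool) :
    (FreeGroup.mk [(i, !b)] : FreeGroup α) = (FreeGroup.mk [(i, b)])⁻¹ := by
  simp [FreeGroup.inv_mk, FreeGroup.invRev]

/-- In a reduced word, a prepended letter can cancel only against the first one. -/
theorem norm_mk_singleton_mul [DecidableEq α] {g : FreeGroup α} {a : α × Bool}
    {l : List (α × Bool)} (hg : g.toWord = a :: l) (p : α × Bool) :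
    (FreeGroup.mk [p] * g).norm = if p = (a.1, !a.2) then g.norm - 1 else g.norm + 1 := by
  have hr : FreeGroup.reduce (a :: l) = a :: l := by rw [← hg, FreeGroup.reduce_toWord]
  have h1 : (FreeGroup.mk [p] * g).norm = (FreeGroup.reduce (p :: a :: l)).length := by
    rw [FreeGroup.norm, FreeGroup.toWord_mul, FreeGroup.toWord_mk, hg]
    simp
  rw [h1, FreeGroup.reduce.cons, hr, FreeGroup.norm, hg]
  obtain ⟨i, b⟩ := p
  obtain ⟨j, c⟩ := a
  by_cases h : i = j ∧ b = !c
  · simp [h]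
  · have h' : ¬ ((i, b) = (j, !c)) := by simpa [Prod.ext_iff] using h
    simp [h, h']

variable {n : ℕ}

theorem sum_norm_neighbors {R : Type*} [CommRing R] (F : ℕ → R) {g : FreeGroup (Fin n)}
    (hg : g ≠ 1) :
    ∑ p : Fin n × Bool, F (FreeGroup.mk [p] * g).norm =
      F (g.norm - 1) + (2 * n - 1) * F (g.norm + 1) := by
  obtain ⟨a, l, hl⟩ : ∃ a l, g.toWord = a :: l :=
    List.exists_cons_of_ne_nil (by simpa using hg)
  simp_rw [norm_mk_singleton_mul hl]
  rw [← Finset.add_sum_erase _ _ (Finset.mem_univ (a.1, !a.2))]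
  rw [Finset.sum_congr rfl (g := fun _ => F (g.norm + 1))]
  · have : 1 ≤ n * 2 := by have := a.1.pos; omega
    simp [Finset.card_erase_of_mem, this]
    ring
  · intro p hp
    rw [if_neg (Finset.ne_of_mem_erase hp)]

theorem sum_norm_neighbors_one {R : Type*} [CommRing R] (F : ℕ → R) :
    ∑ p : Fin n × Bool, F (FreeGroup.mk [p] * (1 : FreeGroup (Fin n))).norm = 2 * n * F 1 := by
  have (p : Fin n × Bool) : (FreeGroup.mk [p]).norm = 1 := by
    simp [FreeGroup.norm, FreeGroup.toWord_mk]
  simp [this]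
  ring

variable (n) in
theorem finite_norm_eq (m : ℕ) : {g : FreeGroup (Fin n) | g.norm = m}.Finite :=
  Set.Finite.of_finite_image ((List.finite_length_eq (Fin n × Bool) m).subset (by
    rintro _ ⟨g, hg, rfl⟩; exact hg)) FreeGroup.toWord_injective.injOn

variable (n) in
/-- The reduced words of length `m` in the free group on `n` generators. -/
noncomputable def sphere (m : ℕ) : Finset (FreeGroup (Fin n)) := (finite_norm_eq n m).toFinset

theorem mem_sphere {m : ℕ} {g : FreeGroup (Fin n)} : g ∈ sphere n m ↔ g.norm = m := by
  simp [sphere]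

/-- Double counting of tree edges: inverting the letter reverses an edge. -/
theorem sum_card_neighbors (A B : Finset (FreeGroup (Fin n))) :
    ∑ g ∈ A, ∑ p : Fin n × Bool, (if FreeGroup.mk [p] * g ∈ B then (1 : ℝ) else 0) =
      ∑ g ∈ B, ∑ p : Fin n × Bool, (if FreeGroup.mk [p] * g ∈ A then (1 : ℝ) else 0) := by
  rw [Finset.sum_comm, Finset.sum_comm (s := B)]
  refine Fintype.sum_equiv ((Equiv.refl _).prodCongr Equiv.boolNot) _ _ fun p => ?_
  have hp : FreeGroup.mk [((Equiv.refl (Fin n)).prodCongr Equiv.boolNot) p] =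
      (FreeGroup.mk [p])⁻¹ := mk_singleton_not p.1 p.2
  rw [hp, Finset.sum_boole, Finset.sum_boole]
  generalize FreeGroup.mk [p] = s
  congr 1
  refine Finset.card_nbij' (s * ·) (s⁻¹ * ·) ?_ ?_ ?_ ?_ <;>
    intro g <;> simp +contextual

theorem card_sphere_succ_succ (m : ℕ) :
    (#(sphere n (m + 2)) : ℝ) = (2 * n - 1) * #(sphere n (m + 1)) := by
  have h := sum_card_neighbors (sphere n (m + 1)) (sphere n (m + 2))
  have h1 : ∀ g ∈ sphere n (m + 1), ∑ p : Fin n × Bool,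
      (if FreeGroup.mk [p] * g ∈ sphere n (m + 2) then (1 : ℝ) else 0) = 2 * n - 1 := by
    intro g hg
    rw [mem_sphere] at hg
    simp_rw [mem_sphere]
    rw [sum_norm_neighbors (fun k => if k = m + 2 then (1 : ℝ) else 0) (by rintro rfl; simp at hg)]
    simp [hg]
  have h2 : ∀ g ∈ sphere n (m + 2), ∑ p : Fin n × Bool,
      (if FreeGroup.mk [p] * g ∈ sphere n (m + 1) then (1 : ℝ) else 0) = 1 := by
    intro g hg
    rw [mem_sphere] at hg
    simp_rw [mem_sphere]
    rw [sum_norm_neighbors (fun k => if k = m + 1 then (1 : ℝ) else 0) (by rintro rfl; simp at hg)]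
    simp [hg]
  rw [Finset.sum_congr rfl h1, Finset.sum_congr rfl h2] at h
  simp only [sum_const, nsmul_eq_mul, mul_one] at h
  linarith

theorem sphere_zero : sphere n 0 = {1} := by
  ext g; simp [mem_sphere]

theorem card_sphere_one : (#(sphere n 1) : ℝ) = 2 * n := by
  have h := sum_card_neighbors (sphere n 0) (sphere n 1)
  have h2 : ∀ g ∈ sphere n 1, ∑ p : Fin n × Bool,
      (if FreeGroup.mk [p] * g ∈ sphere n 0 then (1 : ℝ) else 0) = 1 := by
    intro g hg
    rw [mem_sphere] at hg
    simp_rw [mem_sphere]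
    rw [sum_norm_neighbors (fun k => if k = 0 then (1 : ℝ) else 0) (by rintro rfl; simp at hg)]
    simp [hg]
  rw [Finset.sum_congr rfl h2, sphere_zero, sum_singleton] at h
  simp_rw [mem_sphere] at h
  rw [sum_norm_neighbors_one (fun k => if k = 1 then (1 : ℝ) else 0)] at h
  simpa using h.symm

theorem card_sphere_succ (m : ℕ) :
    (#(sphere n (m + 1)) : ℝ) = 2 * n * (2 * n - 1) ^ m := by
  induction m with
  | zero => simpa using card_sphere_one
  | succ m ih => rw [card_sphere_succ_succ, ih]; ring

end WordLength

/-! ### Upper bound by a Schur test -/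

section UpperBound

/-- The weight of the Schur test between words of lengths `u` and `v`. -/
noncomputable def schurWeight (t : ℝ) (u v : ℕ) : ℝ := if u < v then t else t⁻¹

theorem schurWeight_pos {t : ℝ} (ht : 0 < t) (u v : ℕ) : 0 < schurWeight t u v := by
  unfold schurWeight; split_ifs <;> positivity

theorem schurWeight_le {t : ℝ} (ht : 0 < t) (ht1 : t ≤ 1) (u v : ℕ) :
    schurWeight t u v ≤ t⁻¹ := by
  unfold schurWeight
  split_ifs
  · exact ht1.trans ((one_le_inv₀ ht).2 ht1)
  · exact le_rfl

/-- Asking only for an inequality also covers equal lengths, so it is never needed that neighbours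
differ in length. -/
theorem one_le_schurWeight_mul {t : ℝ} (ht : 0 < t) (ht1 : t ≤ 1) (u v : ℕ) :
    1 ≤ schurWeight t u v * schurWeight t v u := by
  have h1 := (one_le_inv₀ ht).2 ht1
  unfold schurWeight
  split_ifs with h h' h'
  · omega
  · simp [ht.ne']
  · simp [ht.ne']
  · nlinarith

theorem two_mul_mul_le_of_one_le_mul {c d : ℝ} (hc : 0 < c) (h : 1 ≤ c * d) (a b : ℝ) :
    2 * (a * b) ≤ c * a ^ 2 + d * b ^ 2 := by
  have h1 : c⁻¹ ≤ d := by rwa [inv_le_iff_one_le_mul₀' hc]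
  have h2 : c * a ^ 2 + c⁻¹ * b ^ 2 - 2 * (a * b) = c⁻¹ * (c * a - b) ^ 2 := by
    field_simp
    ring
  have h3 : 0 ≤ c⁻¹ * (c * a - b) ^ 2 := by positivity
  have h4 := mul_le_mul_of_nonneg_right h1 (sq_nonneg b)
  linarith

variable {n : ℕ}

theorem sum_schurWeight_le (hn : 1 ≤ n) (g : FreeGroup (Fin n)) :
    ∑ p : Fin n × Bool, schurWeight (√(2 * n - 1))⁻¹ g.norm (FreeGroup.mk [p] * g).norm ≤
      2 * √(2 * n - 1) := by
  have hn' : (1 : ℝ) ≤ n := by exact_mod_cast hn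
  have hq : 0 < √(2 * (n : ℝ) - 1) := Real.sqrt_pos.2 (by linarith)
  have hsq : √(2 * (n : ℝ) - 1) ^ 2 = 2 * n - 1 := Real.sq_sqrt (by linarith)
  by_cases hg : g = 1
  · subst hg
    rw [FreeGroup.norm_one, sum_norm_neighbors_one (schurWeight _ 0)]
    simp only [schurWeight, zero_lt_one, if_true]
    rw [← div_eq_mul_inv, div_le_iff₀ hq]
    -- At the root all 2n steps go outward; 2n ≤ 2(2n - 1) since n ≥ 1.
    nlinarith
  · rw [sum_norm_neighbors _ hg]
    have : ¬ g.norm < g.norm - 1 := by omega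
    simp only [schurWeight, this, if_false, Nat.lt_succ_self, if_true, inv_inv]
    generalize √(2 * (n : ℝ) - 1) = r at hq hsq
    rw [← hsq]
    field_simp
    linarith

theorem summable_mul_translate {G : Type*} [Group G] {f : G → ℝ} (hf0 : ∀ g, 0 ≤ f g)
    (hf : Summable fun g => f g ^ 2) (s : G) : Summable fun g => f (s⁻¹ * g) * f g := by
  have h1 : Summable fun g => f (s⁻¹ * g) ^ 2 := (Equiv.mulLeft s⁻¹).summable_iff.2 hf
  refine Summable.of_nonneg_of_le (fun g => mul_nonneg (hf0 _) (hf0 _)) (fun g => ?_) (h1.add hf)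
  nlinarith [sq_nonneg (f (s⁻¹ * g) - f g), sq_nonneg (f (s⁻¹ * g)), sq_nonneg (f g)]

theorem two_mul_tsum_mul_translate_le {G : Type*} [Group G] {f : G → ℝ} (hf0 : ∀ g, 0 ≤ f g)
    (hf : Summable fun g => f g ^ 2) {c : G → G → ℝ} (hc : ∀ u v, 0 < c u v)
    (hc1 : ∀ u v, 1 ≤ c u v * c v u) (hW : ∀ s, Summable fun g => c g (s * g) * f g ^ 2) (s : G) :
    2 * ∑' g, f (s⁻¹ * g) * f g ≤
      ∑' g, c g (s * g) * f g ^ 2 + ∑' g, c g (s⁻¹ * g) * f g ^ 2 := by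
  have hW' := (Equiv.mulLeft s⁻¹).summable_iff.2 (hW s)
  -- Reindexing puts both endpoints of the edge from s⁻¹g to g into one summand, where weighted
  -- AM-GM applies.
  rw [← (Equiv.mulLeft s⁻¹).tsum_eq fun g => c g (s * g) * f g ^ 2, ← tsum_mul_left]
  simp only [Function.comp_def, Equiv.coe_mulLeft, mul_inv_cancel_left] at hW' ⊢
  rw [← hW'.tsum_add (hW s⁻¹)]
  exact Summable.tsum_le_tsum
    (fun g => two_mul_mul_le_of_one_le_mul (hc _ _) (hc1 _ _) _ _)
    ((summable_mul_translate hf0 hf s).mul_left 2) (hW'.add (hW s⁻¹))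

/-- The Schur test for the adjacency operator of the `2n`-regular tree. -/
theorem sum_tsum_mul_translate_le (hn : 1 ≤ n) {f : FreeGroup (Fin n) → ℝ} (hf0 : ∀ g, 0 ≤ f g)
    (hf : Summable fun g => f g ^ 2) :
    ∑ i, ∑' g, f ((FreeGroup.of i)⁻¹ * g) * f g ≤ √(2 * n - 1) * ∑' g, f g ^ 2 := by
  have hn' : (1 : ℝ) ≤ n := by exact_mod_cast hn
  have hq : 1 ≤ √(2 * (n : ℝ) - 1) := Real.one_le_sqrt.2 (by linarith)
  obtain ⟨t, ht⟩ : ∃ t, t = (√(2 * (n : ℝ) - 1))⁻¹ := ⟨_, rfl⟩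
  have ht0 : 0 < t := by rw [ht]; positivity
  have ht1 : t ≤ 1 := by rw [ht]; exact inv_le_one_of_one_le₀ hq
  let W (s g : FreeGroup (Fin n)) : ℝ := schurWeight t g.norm (s * g).norm * f g ^ 2
  have hW (s) : Summable (W s) := by
    refine Summable.of_nonneg_of_le
      (fun g => mul_nonneg (schurWeight_pos ht0 _ _).le (sq_nonneg _)) (fun g => ?_)
      (hf.mul_left t⁻¹)
    exact mul_le_mul_of_nonneg_right (schurWeight_le ht0 ht1 _ _) (sq_nonneg _)
  have key := two_mul_tsum_mul_translate_le hf0 hf (c := fun u v => schurWeight t u.norm v.norm)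
    (fun _ _ => schurWeight_pos ht0 _ _) (fun _ _ => one_le_schurWeight_mul ht0 ht1 _ _) hW
  have h1 : 2 * ∑ i, ∑' g, f ((FreeGroup.of i)⁻¹ * g) * f g ≤
      ∑ p : Fin n × Bool, ∑' g, W (FreeGroup.mk [p]) g := by
    rw [Fintype.sum_prod_type, mul_sum]
    refine sum_le_sum fun i _ => ?_
    rw [Fintype.sum_bool]
    exact key (FreeGroup.of i)
  have h2 : ∑ p : Fin n × Bool, ∑' g, W (FreeGroup.mk [p]) g ≤
      2 * √(2 * n - 1) * ∑' g, f g ^ 2 := by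
    rw [← Summable.tsum_finsetSum fun p _ => hW _, ← tsum_mul_left]
    refine Summable.tsum_le_tsum (fun g => ?_) (summable_sum fun p _ => hW _) (hf.mul_left _)
    simp only [W]
    rw [← sum_mul, ht]
    exact mul_le_mul_of_nonneg_right (sum_schurWeight_le hn g) (sq_nonneg _)
  linarith

theorem norm_inner_tensorSum_le (hn : 1 ≤ n) {k : ℕ} (U : Fin n → Matrix (Fin k) (Fin k) ℂ)
    (hU : ∀ i, ‖Matrix.toEuclideanCLM (𝕜 := ℂ) (U i)‖ ≤ 1)
    (x : EuclideanSpace ℂ (Fin k) ⊗[ℂ] lp (fun _ : FreeGroup (Fin n) => ℂ) 2) :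
    ‖inner ℂ (tensorSum U (fun i => leftRegular (FreeGroup.of i)) x) x‖ ≤
      √(2 * n - 1) * ‖x‖ ^ 2 := by
  have hx := hasSum_norm_fiber_sq x
  have hs := summable_mul_translate (fun g => norm_nonneg (fiber g x)) hx.summable
  rw [tensorSum, _root_.sum_apply, sum_inner, ← hx.tsum_eq]
  refine (norm_sum_le _ _).trans (le_trans (sum_le_sum fun i _ => ?_)
    (sum_tsum_mul_translate_le hn (fun g => norm_nonneg (fiber g x)) hx.summable))
  rw [← (hasSum_inner_fiber _ _).tsum_eq]
  refine tsum_of_norm_bounded (hs (FreeGroup.of i)).hasSum fun g => ?_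
  rw [fiber_mapL_leftRegular]
  refine (norm_inner_le_norm _ _).trans (mul_le_mul_of_nonneg_right ?_ (norm_nonneg _))
  exact ((ContinuousLinearMap.le_opNorm _ _).trans
    (mul_le_of_le_one_left (norm_nonneg _) (hU i)))

theorem jointNumericalRadius_leftRegular_le (hn : 1 ≤ n) :
    jointNumericalRadius (fun i : Fin n => leftRegular (FreeGroup.of i)) ≤
      √(2 * (n : ℝ) - 1) := by
  refine Real.sSup_le ?_ (Real.sqrt_nonneg _)
  rintro _ ⟨k, rfl⟩
  refine Real.sSup_le ?_ (Real.sqrt_nonneg _)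
  rintro _ ⟨U, hU, rfl⟩
  refine Real.sSup_le ?_ (Real.sqrt_nonneg _)
  rintro _ ⟨x, hx, rfl⟩
  simpa [hx] using norm_inner_tensorSum_le hn U hU x

end UpperBound

/-! ### Comparison of the two radii -/

section Comparison

variable {H : Type*} [NormedAddCommGroup H] [InnerProductSpace ℂ H]

theorem numericalRadius_nonneg (T : H →L[ℂ] H) : 0 ≤ numericalRadius T := by
  refine Real.sSup_nonneg ?_
  rintro _ ⟨h, _, rfl⟩
  exact norm_nonneg _

theorem norm_inner_le_numericalRadius_mul (T : H →L[ℂ] H) (h : H) :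
    ‖inner ℂ (T h) h‖ ≤ numericalRadius T * ‖h‖ ^ 2 := by
  by_cases hh : h = 0
  · simp [hh]
  have h0 : ‖h‖ ≠ 0 := norm_ne_zero_iff.2 hh
  have h1 : ‖((‖h‖⁻¹ : ℝ) : ℂ) • h‖ = 1 := by
    rw [norm_smul]; simp [h0]
  have h2 := le_csSup (bddAbove_numericalRadius T) ⟨_, h1, rfl⟩
  rw [map_smul, inner_smul_left, inner_smul_right] at h2
  simp only [norm_mul, RCLike.norm_conj, Complex.norm_real, norm_inv, norm_norm] at h2
  change _ ≤ numericalRadius T at h2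
  have h3 : 0 < ‖h‖ := lt_of_le_of_ne (norm_nonneg _) h0.symm
  rw [← mul_assoc, ← mul_inv, ← pow_two, inv_mul_le_iff₀ (by positivity)] at h2
  linarith

theorem numericalRadius_sum_le_jointNumericalRadius {n : ℕ} (a : Fin n → H →L[ℂ] H) :
    numericalRadius (∑ i, a i) ≤ jointNumericalRadius a := by
  have hU : ∀ _ : Fin n,
      ‖Matrix.toEuclideanCLM (𝕜 := ℂ) (1 : Matrix (Fin 1) (Fin 1) ℂ)‖ ≤ 1 := by
    intro _
    rw [map_one]
    exact ContinuousLinearMap.norm_id_le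
  have h1 : numericalRadius (tensorSum (fun _ => (1 : Matrix (Fin 1) (Fin 1) ℂ)) a) ≤
      jointNumericalRadius a :=
    (le_csSup (bddAbove_jointNumericalRadiusAt 1 a) ⟨_, hU, rfl⟩).trans
      (le_csSup (bddAbove_jointNumericalRadius a) ⟨1, rfl⟩)
  refine le_trans (Real.sSup_le ?_ (numericalRadius_nonneg _)) h1
  rintro _ ⟨h, hh, rfl⟩
  have h2 := norm_inner_le_numericalRadius_mul
    (tensorSum (fun _ => (1 : Matrix (Fin 1) (Fin 1) ℂ)) a)
    (EuclideanSpace.single (0 : Fin 1) (1 : ℂ) ⊗ₜ h)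
  have h3 : tensorSum (fun _ => (1 : Matrix (Fin 1) (Fin 1) ℂ)) a
      (EuclideanSpace.single (0 : Fin 1) (1 : ℂ) ⊗ₜ h) =
      EuclideanSpace.single (0 : Fin 1) (1 : ℂ) ⊗ₜ (∑ i, a i) h := by
    simp [tensorSum, TensorProduct.tmul_sum]
  rw [h3, TensorProduct.inner_tmul, TensorProduct.norm_tmul, hh] at h2
  simpa [sum_inner] using h2

end Comparison

/-! ### Lower bound by radial test functions -/

section LowerBound

variable {G : Type*}

theorem memℓp_ofReal_of_finset {φ : G → ℝ} {B : Finset G} (hφ : ∀ g ∉ B, φ g = 0) :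
    Memℓp (fun g => (φ g : ℂ)) 2 :=
  memℓp_gen (summable_of_ne_finset_zero (s := B) fun g hg => by simp [hφ g hg])

theorem norm_sq_of_finset {φ : G → ℝ} {B : Finset G} (hφ : ∀ g ∉ B, φ g = 0) :
    ‖(⟨_, memℓp_ofReal_of_finset hφ⟩ : lp (fun _ : G => ℂ) 2)‖ ^ 2 = ∑ g ∈ B, φ g ^ 2 := by
  have h := lp.norm_rpow_eq_tsum (by norm_num : 0 < (2 : ℝ≥0∞).toReal)
    (⟨_, memℓp_ofReal_of_finset hφ⟩ : lp (fun _ : G => ℂ) 2)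
  simp only [ENNReal.toReal_ofNat, Real.rpow_ofNat, Complex.norm_real, Real.norm_eq_abs,
    sq_abs] at h
  rw [h, tsum_eq_sum fun g hg => by simp [hφ g hg]]

/-- For real φ, the inner product is a sum over edges that can be based at either endpoint; adding
both versions gives the symmetric form. -/
theorem two_mul_inner_leftRegular_of_finset [Group G] {φ : G → ℝ} {B : Finset G}
    (hφ : ∀ g ∉ B, φ g = 0) (s : G) :
    2 * inner ℂ (leftRegular s (⟨_, memℓp_ofReal_of_finset hφ⟩ : lp (fun _ : G => ℂ) 2))
      (⟨_, memℓp_ofReal_of_finset hφ⟩ : lp (fun _ : G => ℂ) 2) =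
      ((∑ g ∈ B, φ g * (φ (s * g) + φ (s⁻¹ * g)) : ℝ) : ℂ) := by
  have h1 : inner ℂ (leftRegular s (⟨_, memℓp_ofReal_of_finset hφ⟩ : lp (fun _ : G => ℂ) 2))
      (⟨_, memℓp_ofReal_of_finset hφ⟩ : lp (fun _ : G => ℂ) 2) =
      ∑' g, ((φ g * φ (s⁻¹ * g) : ℝ) : ℂ) := by
    rw [lp.inner_eq_tsum]
    refine tsum_congr fun g => ?_
    rw [leftRegular_apply]
    simp
  have h2 : ∑' g, ((φ g * φ (s⁻¹ * g) : ℝ) : ℂ) = ∑ g ∈ B, ((φ g * φ (s⁻¹ * g) : ℝ) : ℂ) :=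
    tsum_eq_sum fun g hg => by simp [hφ g hg]
  have h3 : ∑' g, ((φ g * φ (s⁻¹ * g) : ℝ) : ℂ) = ∑ g ∈ B, ((φ g * φ (s * g) : ℝ) : ℂ) := by
    rw [← (Equiv.mulLeft s).tsum_eq, tsum_eq_sum (s := B)]
    · refine sum_congr rfl fun g _ => ?_
      simp [mul_comm]
    · intro g hg
      simp [hφ g hg]
  rw [two_mul]
  nth_rewrite 1 [h1, h3]
  rw [h1, h2, ← sum_add_distrib]
  push_cast
  exact sum_congr rfl fun g _ => by ring

variable {n : ℕ}

variable (n) in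
/-- The reduced words of length less than `N` in the free group on `n` generators. -/
noncomputable def openBall (N : ℕ) : Finset (FreeGroup (Fin n)) := (range N).biUnion (sphere n)

theorem mem_openBall {N : ℕ} {g : FreeGroup (Fin n)} : g ∈ openBall n N ↔ g.norm < N := by
  simp [openBall, mem_sphere]

theorem sum_openBall (N : ℕ) (F : ℕ → ℝ) :
    ∑ g ∈ openBall n N, F g.norm = ∑ m ∈ range N, #(sphere n m) * F m := by
  rw [openBall, sum_biUnion]
  · refine sum_congr rfl fun m _ => ?_
    rw [sum_congr rfl (g := fun _ => F m) fun g hg => by rw [mem_sphere.1 hg]]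
    simp
  · intro m _ m' _ hm
    refine disjoint_left.2 fun g hg hg' => hm ?_
    rw [← mem_sphere.1 hg, mem_sphere.1 hg']

theorem two_mul_inner_sum_leftRegular {φ : FreeGroup (Fin n) → ℝ}
    {B : Finset (FreeGroup (Fin n))} (hφ : ∀ g ∉ B, φ g = 0) :
    2 * inner ℂ ((∑ i : Fin n, leftRegular (FreeGroup.of i))
        (⟨_, memℓp_ofReal_of_finset hφ⟩ : lp (fun _ : FreeGroup (Fin n) => ℂ) 2))
      (⟨_, memℓp_ofReal_of_finset hφ⟩ : lp (fun _ : FreeGroup (Fin n) => ℂ) 2) =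
      ((∑ g ∈ B, φ g * ∑ p : Fin n × Bool, φ (FreeGroup.mk [p] * g) : ℝ) : ℂ) := by
  rw [_root_.sum_apply, sum_inner, mul_sum]
  simp_rw [two_mul_inner_leftRegular_of_finset hφ]
  rw [← Complex.ofReal_sum, sum_comm]
  congr 1
  refine sum_congr rfl fun g _ => ?_
  rw [← mul_sum, Fintype.sum_prod_type]
  simp only [Fintype.sum_bool]
  rfl

/-- Testing the quadratic form on the radial function `g ↦ (2n-1)^(-|g|/2)` cut off at length
`M + 1`. -/
theorem sqrt_mul_le_numericalRadius_mul (hn : 1 ≤ n) (M : ℕ) :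
    √(2 * n - 1) * (M * (2 * n / (2 * n - 1))) ≤
      numericalRadius (∑ i : Fin n, leftRegular (FreeGroup.of i)) *
        (1 + (M + 1) * (2 * n / (2 * n - 1))) := by
  have hn' : (1 : ℝ) ≤ n := by exact_mod_cast hn
  have hq0 : 0 < 2 * (n : ℝ) - 1 := by linarith
  have hr : 0 < √(2 * (n : ℝ) - 1) := Real.sqrt_pos.2 hq0
  have hsq : √(2 * (n : ℝ) - 1) ^ 2 = 2 * n - 1 := Real.sq_sqrt hq0.le
  obtain ⟨r, hrr⟩ : ∃ r, r = √(2 * (n : ℝ) - 1) := ⟨_, rfl⟩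
  rw [← hrr] at hr hsq ⊢
  let F (m : ℕ) : ℝ := if m < M + 2 then r⁻¹ ^ m else 0
  have hF0 (m) : 0 ≤ F m := by
    simp only [F]; split_ifs <;> positivity
  have hF {m} (hm : m < M + 2) : F m = r⁻¹ ^ m := if_pos hm
  have hsph (m : ℕ) : (#(sphere n (m + 1)) : ℝ) * (r⁻¹ ^ (m + 1)) ^ 2 = 2 * n / (2 * n - 1) := by
    rw [card_sphere_succ, ← hsq, inv_pow]
    field_simp
    ring
  let φ (g : FreeGroup (Fin n)) : ℝ := F g.norm
  have hφ : ∀ g ∉ openBall n (M + 2), φ g = 0 := fun g hg => if_neg (by rwa [← mem_openBall])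
  have hnorm : ∑ g ∈ openBall n (M + 2), φ g ^ 2 = 1 + (M + 1) * (2 * n / (2 * n - 1)) := by
    rw [sum_openBall (M + 2) (fun m => F m ^ 2), sum_range_succ', sphere_zero]
    rw [sum_congr rfl (g := fun _ => 2 * (n : ℝ) / (2 * n - 1))]
    · simp [hF]; ring
    · intro m hm
      rw [hF (by simpa using hm), hsph]
  have hlow : 2 * r * (M * (2 * n / (2 * n - 1))) ≤
      ∑ g ∈ openBall n (M + 2), φ g * ∑ p : Fin n × Bool, φ (FreeGroup.mk [p] * g) := by
    -- Only lengths 1 to M are kept: there both neighbouring layers lie in the support, and the form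
    -- is exactly 2r times the mass. The discarded terms are nonnegative.
    let K (m : ℕ) : ℝ := if m = 0 ∨ M < m then 0 else 2 * r * (r⁻¹ ^ m) ^ 2
    have hK : ∀ g ∈ openBall n (M + 2),
        K g.norm ≤ φ g * ∑ p : Fin n × Bool, φ (FreeGroup.mk [p] * g) := by
      intro g _
      by_cases hg : g.norm = 0 ∨ M < g.norm
      · simp only [K, if_pos hg]
        exact mul_nonneg (hF0 _) (sum_nonneg fun p _ => hF0 _)
      · simp only [K, if_neg hg, φ]
        push Not at hg
        have hg1 : g ≠ 1 := fun h => hg.1 (by simp [h])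
        obtain ⟨m, hm⟩ := Nat.exists_eq_succ_of_ne_zero hg.1
        rw [sum_norm_neighbors F hg1, ← hsq, hm, hF (by omega), hF (by omega), hF (by omega)]
        refine le_of_eq ?_
        simp only [Nat.succ_eq_add_one, Nat.add_sub_cancel, inv_pow]
        field_simp
        ring
    refine le_trans (le_of_eq ?_) (sum_le_sum hK)
    rw [sum_openBall, sum_range_succ', sum_range_succ]
    rw [sum_congr rfl (g := fun _ => 2 * r * (2 * (n : ℝ) / (2 * n - 1)))]
    · simp [K]; ring
    · intro m hm
      have : ¬ (m + 1 = 0 ∨ M < m + 1) := by have := mem_range.1 hm; omega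
      simp only [K, if_neg this]
      rw [← hsph m]; ring
  have h1 := norm_inner_le_numericalRadius_mul (∑ i : Fin n, leftRegular (FreeGroup.of i))
    (⟨_, memℓp_ofReal_of_finset hφ⟩ : lp (fun _ : FreeGroup (Fin n) => ℂ) 2)
  have h2 := congrArg norm (two_mul_inner_sum_leftRegular hφ)
  rw [norm_mul, Complex.norm_real, Complex.norm_ofNat] at h2
  have h3 := le_abs_self
    (∑ g ∈ openBall n (M + 2), φ g * ∑ p : Fin n × Bool, φ (FreeGroup.mk [p] * g))
  rw [← Real.norm_eq_abs, ← h2] at h3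
  rw [norm_sq_of_finset hφ, hnorm] at h1
  linarith

theorem sqrt_le_numericalRadius_sum_leftRegular (hn : 1 ≤ n) :
    √(2 * (n : ℝ) - 1) ≤ numericalRadius (∑ i : Fin n, leftRegular (FreeGroup.of i)) := by
  have hn' : (1 : ℝ) ≤ n := by exact_mod_cast hn
  by_contra! hlt
  have key := sqrt_mul_le_numericalRadius_mul hn
  generalize numericalRadius (∑ i : Fin n, leftRegular (FreeGroup.of i)) = w at hlt key
  generalize √(2 * (n : ℝ) - 1) = r at hlt key
  have hα : 0 < 2 * (n : ℝ) / (2 * n - 1) := div_pos (by linarith) (by linarith)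
  generalize 2 * (n : ℝ) / (2 * n - 1) = α at hα key
  -- `key M` rearranges to (r - w)αM ≤ w(1 + α), which fails for large M.
  obtain ⟨M, hM⟩ := exists_nat_gt (w * (1 + α) / ((r - w) * α))
  rw [div_lt_iff₀ (mul_pos (sub_pos.2 hlt) hα)] at hM
  linarith [key M]

end LowerBound

end JointNumericalRadius

theorem mainTheorem9 (n : ℕ) (hn : 1 ≤ n) :
    JointNumericalRadius.jointNumericalRadius
        (fun i : Fin n => JointNumericalRadius.leftRegular (FreeGroup.of i)) =
      JointNumericalRadius.numericalRadius
        (∑ i : Fin n, JointNumericalRadius.leftRegular (FreeGroup.of i)) ∧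
    JointNumericalRadius.numericalRadius
        (∑ i : Fin n, JointNumericalRadius.leftRegular (FreeGroup.of i)) =
      √(2 * (n : ℝ) - 1) := by
  have h1 := JointNumericalRadius.jointNumericalRadius_leftRegular_le hn
  have h2 := JointNumericalRadius.sqrt_le_numericalRadius_sum_leftRegular hn
  have h3 := JointNumericalRadius.numericalRadius_sum_le_jointNumericalRadius
    (fun i : Fin n => JointNumericalRadius.leftRegular (FreeGroup.of i))
  exact ⟨le_antisymm (h1.trans h2) h3, le_antisymm (h3.trans h1) h2⟩
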